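/- Let $\ell^\infty(\mathbb Z)$ be the Banach space of bounded functions $f:\mathbb Z\to\mathbb C$ and let $\Delta$ be the bounded operator on it given by the finite difference Laplacian, $(\Delta f)(x)=f(x+1)+f(x-1)-2f(x)$. For $t\in\mathbb R$ let $e^{it\Delta}=\sum_{k\ge 0}(it\Delta)^k/k!$, and let $\delta_j$ denote the function on $\mathbb Z$ equal to $1$ at $j$ and $0$ elsewhere. **Lemma A.** There is a constant $\delta>0$ such that for every $t\ge 0$ there are coefficients $a_j\in\mathbb C$ $(j\in\mathbb Z)$, which may depend on $t$, with $|a_j|\le 1$ for all $j$, such that the solution $\psi(t,\cdot)=e^{it\Delta}\psi_0$ of the linear lattice Schrödinger equation with initial datum $\psi_0=\sum_{j\in\mathbb Z}a_j\delta_j$ (pointwise sum) satisfies $$|\psi(t,0)|\ge \delta\, t^{1/2}.$$ -/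

import Mathlib

open scoped ENNReal

noncomputable section

namespace LatticeSchrodinger

/-- The Banach space `ℓ^∞(ℤ)` of bounded complex-valued functions on the lattice `ℤ`. -/
def LInf : Type := lp (fun _ : ℤ => ℂ) ∞

instance : NormedAddCommGroup LInf :=
  inferInstanceAs (NormedAddCommGroup (lp (fun _ : ℤ => ℂ) ∞))

instance : NormedSpace ℂ LInf := inferInstanceAs (NormedSpace ℂ (lp (fun _ : ℤ => ℂ) ∞))

instance : CompleteSpace LInf := inferInstanceAs (CompleteSpace (lp (fun _ : ℤ => ℂ) ∞))

instance : CoeFun LInf (fun _ => ℤ → ℂ) := ⟨fun f => f.1⟩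

/-- The difference operator `f ↦ (x ↦ f (x + s) - f x)` as a bounded operator on `ℓ^∞(ℤ)`. -/
def diff (s : ℤ) : LInf →L[ℂ] LInf :=
  LinearMap.mkContinuous
    { toFun := fun f =>
        ⟨fun x => f (x + s) - f x, memℓp_infty ⟨‖f‖ + ‖f‖, by
          rintro _ ⟨x, rfl⟩
          exact (norm_sub_le _ _).trans
            (add_le_add (lp.norm_apply_le_norm ENNReal.top_ne_zero f _)
              (lp.norm_apply_le_norm ENNReal.top_ne_zero f _))⟩⟩
      map_add' := fun f g => by
        refine Subtype.ext (funext fun x => ?_)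
        exact add_sub_add_comm (f (x + s)) (g (x + s)) (f x) (g x)
      map_smul' := fun c f => by
        refine Subtype.ext (funext fun x => ?_)
        exact (smul_sub c (f (x + s)) (f x)).symm }
    2
    (fun f => lp.norm_le_of_forall_le (by positivity) fun x => by
      have h1 := lp.norm_apply_le_norm ENNReal.top_ne_zero f (x + s)
      have h2 := lp.norm_apply_le_norm ENNReal.top_ne_zero f x
      exact (norm_sub_le _ _).trans ((add_le_add h1 h2).trans_eq (two_mul ‖f‖).symm))

/-- The forward difference `(∂ f) x = f (x + 1) - f x`. -/
def del : LInf →L[ℂ] LInf := diff 1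

/-- The adjoint difference `(∂* f) x = f (x - 1) - f x`. -/
def delStar : LInf →L[ℂ] LInf := diff (-1)

/-- The finite difference Laplacian on `ℤ`, normalized by `-Δ = ∂* ∂`. -/
def laplacian : LInf →L[ℂ] LInf := -(delStar * del)

theorem laplacian_apply (f : LInf) (x : ℤ) :
    laplacian f x = f (x + 1) + f (x - 1) - 2 * f x := by
  change -((f (x + -1 + 1) - f (x + -1)) - (f (x + 1) - f x)) = _
  rw [neg_add_cancel_right, ← sub_eq_add_neg]
  ring

/-- The linear Schrödinger evolution `e^{itΔ}`: the exponential (convergent power series) of the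
bounded operator `itΔ` on `ℓ^∞(ℤ)`. -/
def evolution (t : ℝ) : LInf →L[ℂ] LInf :=
  NormedSpace.exp ((Complex.I * (t : ℂ)) • laplacian)

/-- The lattice delta function `δ_j` at the site `j`. -/
def delta (j : ℤ) : ℤ → ℂ := Pi.single j 1

theorem tsum_delta (a : ℤ → ℂ) (n : ℤ) : ∑' j, a j * delta j n = a n := by
  rw [tsum_eq_single n]
  · simp [delta]
  · intro j hj
    simp [delta, Pi.single_eq_of_ne hj.symm]

/-- The initial datum `ψ₀ = ∑_j a_j δ_j` (the sum is taken pointwise on `ℤ`, where it has at most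
one nonzero term), for coefficients with `|a_j| ≤ 1`. -/
def initialDatum (a : ℤ → ℂ) (ha : ∀ j, ‖a j‖ ≤ 1) : LInf :=
  ⟨fun n => ∑' j, a j * delta j n, memℓp_infty ⟨1, by
    rintro _ ⟨n, rfl⟩
    simpa only [tsum_delta] using ha n⟩⟩

end LatticeSchrodinger

end

namespace LatticeSchrodinger

open Real intervalIntegral

/-! By Fourier inversion, run backwards from time `t` a state whose value at the origin is `π`: its
symbol is `cos θ * e^{iθ}`. The resulting datum is an oscillatory integral with phase `N θ - 2t cos
θ`. Its second derivative `2t cos θ` vanishes where stationary points can degenerate, which alone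
would give only `t^{-1/3}`; the factor `cos θ` vanishes there too and restores `t^{-1/2}` uniformly
in `N` (`norm_integral_cos_mul_exp_le`). Rescaling the datum to sup norm at most `1` gains `t^{1/2}`
at the origin. -/

/-! ### Uniform stationary phase estimate -/

theorem integral_cos_mul_div_sq_add_le {x : ℝ} (hx : 0 < x) (N a b : ℝ) :
    ∫ θ in a..b, x * cos θ / ((N + x * sin θ) ^ 2 + x) ≤ π / √x := by
  have hs : 0 < √x := sqrt_pos.2 hx
  have hsq : √x ^ 2 = x := sq_sqrt hx.le
  have hderiv : ∀ θ ∈ Set.uIcc a b,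
      HasDerivAt (fun θ => arctan ((N + x * sin θ) / √x) / √x)
        (x * cos θ / ((N + x * sin θ) ^ 2 + x)) θ := by
    intro θ _
    have h := (((((hasDerivAt_sin θ).const_mul x).const_add N).div_const √x).arctan).div_const √x
    refine h.congr_deriv ?_
    have h1 : (N + x * sin θ) ^ 2 + x ≠ 0 := by positivity
    have h2 : 1 + ((N + x * sin θ) / √x) ^ 2 = ((N + x * sin θ) ^ 2 + x) / x := by
      rw [div_pow, hsq]; field_simp; ring
    rw [h2]
    field_simp
    rw [hsq, mul_comm]
  have hcont : Continuous fun θ => x * cos θ / ((N + x * sin θ) ^ 2 + x) :=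
    Continuous.div (by fun_prop) (by fun_prop) fun θ => by positivity
  rw [integral_eq_sub_of_hasDerivAt hderiv (hcont.intervalIntegrable _ _), ← sub_div]
  gcongr
  linarith [arctan_lt_pi_div_two ((N + x * sin b) / √x),
    neg_pi_div_two_lt_arctan ((N + x * sin a) / √x)]

/-- `cos` has constant sign on each half of this period, so the arctangent bound applies once per
half. -/
theorem integral_abs_cos_mul_div_sq_add_le {x : ℝ} (hx : 0 < x) (N : ℝ) :
    ∫ θ in (-(π / 2))..(3 * π / 2), x * |cos θ| / ((N + x * sin θ) ^ 2 + x) ≤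
      2 * (π / √x) := by
  have hpi := pi_pos
  have hcont : Continuous fun θ => x * |cos θ| / ((N + x * sin θ) ^ 2 + x) :=
    Continuous.div (by fun_prop) (by fun_prop) fun θ => by positivity
  rw [← integral_add_adjacent_intervals (b := π / 2) (hcont.intervalIntegrable _ _)
    (hcont.intervalIntegrable _ _), two_mul]
  gcongr
  · refine le_of_eq_of_le (integral_congr fun θ hθ => ?_)
      (integral_cos_mul_div_sq_add_le hx N (-(π / 2)) (π / 2))
    rw [Set.uIcc_of_le (by linarith)] at hθ
    simp only [abs_of_nonneg (cos_nonneg_of_mem_Icc hθ)]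
  · rw [integral_symm]
    refine le_of_eq_of_le ?_ (integral_cos_mul_div_sq_add_le hx N (3 * π / 2) (π / 2))
    rw [integral_symm (π / 2) (3 * π / 2), neg_neg, integral_symm (π / 2) (3 * π / 2),
      ← integral_neg]
    refine integral_congr fun θ hθ => ?_
    rw [Set.uIcc_of_le (by linarith)] at hθ
    simp only [abs_of_nonpos (cos_nonpos_of_pi_div_two_le_of_le hθ.1 (by linarith [hθ.2]))]
    ring

theorem abs_div_sq_add_le {x : ℝ} (hx : 0 < x) (v : ℝ) : |v / (v ^ 2 + x)| ≤ 1 / (2 * √x) := by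
  have hs : 0 < √x := sqrt_pos.2 hx
  have hsq : √x ^ 2 = x := sq_sqrt hx.le
  have hd : 0 < v ^ 2 + x := by positivity
  rw [abs_div, abs_of_pos hd, div_le_div_iff₀ hd (by positivity), ← sq_abs v]
  nlinarith [sq_nonneg (|v| - √x)]

theorem hasDerivAt_cos_mul_div_sq_add {x : ℝ} (hx : 0 < x) (N θ : ℝ) :
    HasDerivAt (fun θ => cos θ * ((N + x * sin θ) / ((N + x * sin θ) ^ 2 + x)))
      (-sin θ * ((N + x * sin θ) / ((N + x * sin θ) ^ 2 + x)) +
        x * cos θ ^ 2 * (x - (N + x * sin θ) ^ 2) / ((N + x * sin θ) ^ 2 + x) ^ 2) θ := by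
  have hd : (N + x * sin θ) ^ 2 + x ≠ 0 := by positivity
  have hv : HasDerivAt (fun θ => N + x * sin θ) (x * cos θ) θ :=
    ((hasDerivAt_sin θ).const_mul x).const_add N
  have h := (hasDerivAt_cos θ).mul (hv.div ((hv.pow 2).add_const x) hd)
  refine h.congr_deriv ?_
  simp only [Pi.pow_apply, Pi.div_apply]
  field_simp
  ring

theorem abs_deriv_cos_mul_div_sq_add_le {x : ℝ} (hx : 0 < x) (N θ : ℝ) :
    |-sin θ * ((N + x * sin θ) / ((N + x * sin θ) ^ 2 + x)) +
        x * cos θ ^ 2 * (x - (N + x * sin θ) ^ 2) / ((N + x * sin θ) ^ 2 + x) ^ 2| ≤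
      1 / (2 * √x) + x * |cos θ| / ((N + x * sin θ) ^ 2 + x) := by
  set v := N + x * sin θ
  have hd : 0 < v ^ 2 + x := by positivity
  refine (abs_add_le _ _).trans (add_le_add ?_ ?_)
  · rw [abs_mul, abs_neg]
    exact (mul_le_of_le_one_left (abs_nonneg _) (abs_sin_le_one θ)).trans (abs_div_sq_add_le hx v)
  · have h1 : |x - v ^ 2| ≤ v ^ 2 + x := by
      rw [abs_le]; constructor <;> nlinarith [sq_nonneg v]
    have h2 : cos θ ^ 2 ≤ |cos θ| := by
      rw [← sq_abs]; nlinarith [abs_nonneg (cos θ), abs_cos_le_one θ]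
    rw [abs_div, abs_mul, abs_mul, abs_of_pos hx, abs_of_nonneg (sq_nonneg (cos θ)),
      abs_of_pos (pow_pos hd 2), div_le_div_iff₀ (pow_pos hd 2) hd]
    calc x * cos θ ^ 2 * |x - v ^ 2| * (v ^ 2 + x)
        ≤ x * |cos θ| * (v ^ 2 + x) * (v ^ 2 + x) := by gcongr
      _ = _ := by ring

/-- The uniform stationary phase bound: the weight `cos θ` degenerates exactly where the second
derivative of the phase `N θ - x cos θ` does. -/
theorem norm_integral_cos_mul_exp_le {x : ℝ} (hx : 0 < x) (N : ℤ) :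
    ‖∫ θ in (-(π / 2))..(3 * π / 2),
        (cos θ : ℂ) * Complex.exp (((N * θ - x * cos θ : ℝ) : ℂ) * Complex.I)‖ ≤
      5 * π / √x := by
  have hpi := pi_pos
  have hs : 0 < √x := sqrt_pos.2 hx
  have hdpos : ∀ θ, (N + x * sin θ) ^ 2 + x ≠ 0 := fun θ => by positivity
  set E : ℝ → ℂ := fun θ => Complex.exp (((N * θ - x * cos θ : ℝ) : ℂ) * Complex.I) with hE
  -- With `v = N + x * sin θ` the phase derivative, `q = v / (v ^ 2 + x)` regularizes the multiplier
  -- `1 / v` of integration by parts at scale `√x`, so zeros of `v` need no case split.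
  set q : ℝ → ℝ := fun θ => (N + x * sin θ) / ((N + x * sin θ) ^ 2 + x) with hq
  set r : ℝ → ℝ := fun θ => -sin θ * q θ +
        x * cos θ ^ 2 * (x - (N + x * sin θ) ^ 2) / ((N + x * sin θ) ^ 2 + x) ^ 2 with hr
  have hEderiv : ∀ θ, HasDerivAt E (E θ * (((N + x * sin θ : ℝ) : ℂ) * Complex.I)) θ := by
    intro θ
    have h : HasDerivAt (fun θ : ℝ => N * θ - x * cos θ) (N + x * sin θ) θ := by
      refine (((hasDerivAt_id θ).const_mul (N : ℝ)).sub ((hasDerivAt_cos θ).const_mul x)).congr_deriv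
        ?_
      ring
    exact (h.ofReal_comp.mul_const Complex.I).cexp
  have hGderiv : ∀ θ, HasDerivAt (fun θ => ((cos θ * q θ : ℝ) : ℂ)) (r θ : ℂ) θ := fun θ =>
    (hasDerivAt_cos_mul_div_sq_add hx N θ).ofReal_comp
  have hHderiv : ∀ θ, HasDerivAt (fun θ => ((cos θ * q θ : ℝ) : ℂ) * E θ * -Complex.I)
      (((r θ : ℂ) * E θ + ((cos θ * q θ : ℝ) : ℂ) *
        (E θ * (((N + x * sin θ : ℝ) : ℂ) * Complex.I))) * -Complex.I) θ := fun θ =>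
    ((hGderiv θ).mul (hEderiv θ)).mul_const _
  have hEcont : Continuous E := by fun_prop
  have hqcont : Continuous q := Continuous.div (by fun_prop) (by fun_prop) hdpos
  have hrcont : Continuous r :=
    Continuous.add (by fun_prop) (Continuous.div (by fun_prop) (by fun_prop)
      fun θ => pow_ne_zero 2 (hdpos θ))
  set H' : ℝ → ℂ := fun θ => ((r θ : ℂ) * E θ + ((cos θ * q θ : ℝ) : ℂ) *
        (E θ * (((N + x * sin θ : ℝ) : ℂ) * Complex.I))) * -Complex.I with hH'
  have hH'cont : Continuous H' := by fun_prop
  -- The period starts at a zero of `cos`, so both boundary terms vanish.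
  have hint : ∫ θ in (-(π / 2))..(3 * π / 2), H' θ = 0 := by
    rw [integral_eq_sub_of_hasDerivAt (fun θ _ => hHderiv θ) (hH'cont.intervalIntegrable _ _)]
    have h1 : cos (3 * π / 2) = 0 := by
      rw [show 3 * π / 2 = π / 2 + π by ring, cos_add_pi, cos_pi_div_two, neg_zero]
    simp [h1]
  have hbound : ∀ θ, ‖(cos θ : ℂ) * E θ - H' θ‖ ≤
      1 / (2 * √x) + 2 * (x * |cos θ| / ((N + x * sin θ) ^ 2 + x)) := by
    intro θ
    have hEn : ‖E θ‖ = 1 := Complex.norm_exp_ofReal_mul_I _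
    have hqv : q θ * (N + x * sin θ) = 1 - x / ((N + x * sin θ) ^ 2 + x) := by
      have := hdpos θ
      simp only [hq]; field_simp; ring
    have hqv' : (q θ : ℂ) * ((N + x * sin θ : ℝ) : ℂ) =
        1 - ((x / ((N + x * sin θ) ^ 2 + x) : ℝ) : ℂ) := by exact_mod_cast hqv
    have hsplit : (cos θ : ℂ) * E θ - H' θ =
        ((cos θ * (x / ((N + x * sin θ) ^ 2 + x)) : ℝ) : ℂ) * E θ +
          (r θ : ℂ) * (E θ * Complex.I) := by
      have e1 : H' θ = (cos θ : ℂ) * E θ * ((q θ : ℂ) * ((N + x * sin θ : ℝ) : ℂ)) -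
          (r θ : ℂ) * (E θ * Complex.I) := by
        simp only [hH', Complex.ofReal_mul (cos θ)]
        linear_combination (-(cos θ : ℂ) * q θ * E θ * ((N + x * sin θ : ℝ) : ℂ)) * Complex.I_sq
      rw [e1, hqv', Complex.ofReal_mul]
      ring
    rw [hsplit]
    refine (norm_add_le _ _).trans ?_
    rw [norm_mul, norm_mul, norm_mul, hEn, Complex.norm_I, Complex.norm_real, Complex.norm_real,
      norm_eq_abs, norm_eq_abs]
    have h1 := abs_deriv_cos_mul_div_sq_add_le hx N θ
    have h2 : |cos θ * (x / ((N + x * sin θ) ^ 2 + x))| =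
        x * |cos θ| / ((N + x * sin θ) ^ 2 + x) := by
      have : 0 < x / ((N + x * sin θ) ^ 2 + x) := by positivity
      rw [abs_mul, abs_of_pos this]; ring
    rw [h2]
    simp only [hr, hq]
    linarith
  have hccont : Continuous fun θ => x * |cos θ| / ((N + x * sin θ) ^ 2 + x) :=
    Continuous.div (by fun_prop) (by fun_prop) hdpos
  have hcosE : Continuous fun θ : ℝ => (cos θ : ℂ) * E θ := by fun_prop
  have hsub := integral_sub (μ := MeasureTheory.volume) (a := -(π / 2)) (b := 3 * π / 2)
    (hcosE.intervalIntegrable _ _) (hH'cont.intervalIntegrable _ _)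
  rw [hint, sub_zero] at hsub
  rw [← hsub]
  refine (norm_integral_le_of_norm_le (by linarith)
    (Filter.Eventually.of_forall fun θ _ => hbound θ)
    (Continuous.intervalIntegrable (by fun_prop) _ _)).trans ?_
  rw [integral_add (Continuous.intervalIntegrable (by fun_prop) _ _)
    (Continuous.intervalIntegrable (by fun_prop) _ _), integral_const, integral_const_mul]
  have h := integral_abs_cos_mul_div_sq_add_le hx N
  -- The constant is `5 = 1 + 2 * 2`: this term plus twice the bound on the `|cos θ|` integral.
  have h2 : (3 * π / 2 - -(π / 2)) • (1 / (2 * √x)) = π / √x := by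
    rw [smul_eq_mul]; field_simp; ring
  rw [h2, mul_div_assoc 5]
  linarith

/-! ### Evolution of wave packets -/

/-- The bounded function `n ↦ ∫ w(θ) e^{inθ} dθ`, the integral being over one period. -/
noncomputable def wavePacket (w : C(ℝ, ℂ)) : LInf :=
  ⟨fun n => ∫ θ in (-(π / 2))..(3 * π / 2), w θ * Complex.exp ((n * θ : ℝ) * Complex.I),
    memℓp_infty ⟨∫ θ in (-(π / 2))..(3 * π / 2), ‖w θ‖, by
      rintro _ ⟨n, rfl⟩
      refine norm_integral_le_of_norm_le (by linarith [pi_pos])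
        (Filter.Eventually.of_forall fun θ _ => ?_)
        (Continuous.intervalIntegrable (by fun_prop) _ _)
      rw [norm_mul, Complex.norm_exp_ofReal_mul_I, mul_one]⟩⟩

theorem wavePacket_apply (w : C(ℝ, ℂ)) (n : ℤ) :
    wavePacket w n = ∫ θ in (-(π / 2))..(3 * π / 2),
      w θ * Complex.exp ((n * θ : ℝ) * Complex.I) := rfl

/-- The symbol `2 cos θ - 2` of the Laplacian. -/
noncomputable def symbol : C(ℝ, ℂ) := ⟨fun θ => ((2 * cos θ - 2 : ℝ) : ℂ), by fun_prop⟩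

theorem smul_laplacian_wavePacket (c : ℂ) (w : C(ℝ, ℂ)) :
    (c • laplacian) (wavePacket w) = wavePacket (c • symbol * w) := by
  refine Subtype.ext (funext fun n => ?_)
  change c * laplacian (wavePacket w) n = wavePacket (c • symbol * w) n
  rw [laplacian_apply]
  simp only [wavePacket_apply]
  rw [← integral_const_mul, ← integral_add, ← integral_sub, ← integral_const_mul]
  · refine integral_congr fun θ _ => ?_
    have h1 : Complex.exp ((((n + 1 : ℤ) : ℝ) * θ : ℝ) * Complex.I) =
        Complex.exp ((n * θ : ℝ) * Complex.I) * Complex.exp (θ * Complex.I) := by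
      rw [← Complex.exp_add]; push_cast; ring_nf
    have h2 : Complex.exp ((((n - 1 : ℤ) : ℝ) * θ : ℝ) * Complex.I) =
        Complex.exp ((n * θ : ℝ) * Complex.I) * Complex.exp (-θ * Complex.I) := by
      rw [← Complex.exp_add]; push_cast; ring_nf
    have h3 := Complex.two_cos (θ : ℂ)
    simp only [h1, h2, ContinuousMap.mul_apply, ContinuousMap.smul_apply, symbol,
      ContinuousMap.coe_mk, smul_eq_mul]
    push_cast
    rw [h3]
    ring
  all_goals exact Continuous.intervalIntegrable (by fun_prop) _ _

theorem smul_laplacian_pow_wavePacket (c : ℂ) (k : ℕ) (w : C(ℝ, ℂ)) :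
    ((c • laplacian) ^ k) (wavePacket w) = wavePacket ((c • symbol) ^ k * w) := by
  induction k with
  | zero => simp
  | succ k ih =>
    rw [pow_succ', mul_apply_eq_comp, ih, smul_laplacian_wavePacket, pow_succ',
      mul_assoc]

/-- Evaluation at a site, as a bounded functional on `ℓ^∞(ℤ)`. -/
noncomputable def evalAt (n : ℤ) : LInf →L[ℂ] ℂ :=
  LinearMap.mkContinuous
    { toFun := fun f => f n
      map_add' := fun _ _ => rfl
      map_smul' := fun _ _ => rfl }
    1 fun f => by
      rw [one_mul]
      exact lp.norm_apply_le_norm ENNReal.top_ne_zero f n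

/-- Powers of the Laplacian multiply the weight by powers of the symbol; dominated convergence sums
the exponential series under the integral. -/
theorem evolution_wavePacket_apply (t : ℝ) (w : C(ℝ, ℂ)) (n : ℤ) :
    evolution t (wavePacket w) n = ∫ θ in (-(π / 2))..(3 * π / 2),
      Complex.exp (Complex.I * t * symbol θ) * w θ *
        Complex.exp ((n * θ : ℝ) * Complex.I) := by
  set c : ℂ := Complex.I * t with hc
  have h1 : HasSum (fun k : ℕ => ((k.factorial : ℂ)⁻¹) * wavePacket ((c • symbol) ^ k * w) n)
      (evolution t (wavePacket w) n) := by
    have h := (NormedSpace.exp_series_hasSum_exp' (𝕂 := ℂ) (c • laplacian)).mapL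
      ((evalAt n).comp (ContinuousLinearMap.apply ℂ LInf (wavePacket w)))
    refine h.congr_fun fun k => ?_
    rw [← smul_laplacian_pow_wavePacket]
    rfl
  refine h1.unique ?_
  simp only [wavePacket_apply, ← integral_const_mul]
  refine hasSum_integral_of_dominated_convergence
    (fun k θ => (k.factorial : ℝ)⁻¹ * (‖c‖ * 4) ^ k * ‖w θ‖) (fun k => ?_) (fun k => ?_) ?_ ?_ ?_
  · exact Continuous.aestronglyMeasurable (by fun_prop)
  · refine Filter.Eventually.of_forall fun θ _ => ?_
    have hsym : ‖symbol θ‖ ≤ 4 := by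
      change ‖((2 * cos θ - 2 : ℝ) : ℂ)‖ ≤ 4
      rw [Complex.norm_real, norm_eq_abs, abs_le]
      constructor <;> linarith [cos_le_one θ, neg_one_le_cos θ]
    simp only [ContinuousMap.mul_apply, ContinuousMap.pow_apply, ContinuousMap.smul_apply,
      smul_eq_mul, norm_mul, norm_pow, Complex.norm_exp_ofReal_mul_I, norm_inv,
      Complex.norm_natCast, mul_one, ← mul_assoc]
    gcongr
  · refine Filter.Eventually.of_forall fun θ _ => Summable.mul_right _ ?_
    refine (Real.summable_pow_div_factorial (‖c‖ * 4)).congr fun k => ?_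
    rw [div_eq_inv_mul]
  · simp_rw [tsum_mul_right]
    exact Continuous.intervalIntegrable (by fun_prop) _ _
  · refine Filter.Eventually.of_forall fun θ _ => ?_
    have h := (NormedSpace.exp_series_hasSum_exp' (𝕂 := ℂ) (c * symbol θ))
    rw [← Complex.exp_eq_exp_ℂ] at h
    refine ((h.mul_right (w θ)).mul_right _).congr_fun fun k => ?_
    simp only [ContinuousMap.mul_apply, ContinuousMap.pow_apply, ContinuousMap.smul_apply,
      smul_eq_mul]
    ring

/-! ### The focusing datum -/

/-- The weight whose wave packet refocuses at the origin at time `t`. -/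
noncomputable def focusingWeight (t : ℝ) : C(ℝ, ℂ) :=
  ⟨fun θ => (cos θ : ℂ) * Complex.exp (θ * Complex.I) *
    Complex.exp (-(Complex.I * t * symbol θ)), by fun_prop⟩

theorem norm_wavePacket_focusingWeight_le {t : ℝ} (ht : 0 < t) (n : ℤ) :
    ‖wavePacket (focusingWeight t) n‖ ≤ 5 * π / √(2 * t) := by
  refine le_of_eq_of_le ?_ (norm_integral_cos_mul_exp_le (by positivity : 0 < 2 * t) (n + 1))
  have h : wavePacket (focusingWeight t) n = Complex.exp ((2 * t : ℝ) * Complex.I) *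
      ∫ θ in (-(π / 2))..(3 * π / 2), (cos θ : ℂ) *
        Complex.exp (((((n + 1 : ℤ) : ℝ) * θ - 2 * t * cos θ : ℝ) : ℂ) * Complex.I) := by
    rw [wavePacket_apply, ← integral_const_mul]
    refine integral_congr fun θ _ => ?_
    simp only [focusingWeight, symbol, ContinuousMap.coe_mk]
    rw [mul_assoc, mul_assoc, ← Complex.exp_add, ← Complex.exp_add, mul_left_comm,
      ← Complex.exp_add]
    push_cast
    ring_nf
  rw [h, norm_mul, Complex.norm_exp_ofReal_mul_I, one_mul]

/-- The factor `e^{iθ}` is what makes this nonzero: `cos` alone has mean zero. -/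
theorem integral_cos_mul_exp_I :
    ∫ θ in (-(π / 2))..(3 * π / 2), (cos θ : ℂ) * Complex.exp (θ * Complex.I) = π := by
  have hderiv : ∀ θ : ℝ, HasDerivAt
      (fun θ : ℝ => (θ : ℂ) / 2 + Complex.exp (2 * θ * Complex.I) * (-Complex.I / 4))
      ((cos θ : ℂ) * Complex.exp (θ * Complex.I)) θ := by
    intro θ
    have h0 : HasDerivAt (fun θ : ℝ => (θ : ℂ)) 1 θ := (hasDerivAt_id θ).ofReal_comp
    refine ((h0.div_const 2).add
      (((h0.const_mul 2).mul_const Complex.I).cexp.mul_const _)).congr_deriv ?_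
    have h1 : Complex.exp (2 * θ * Complex.I) =
        Complex.exp (θ * Complex.I) * Complex.exp (θ * Complex.I) := by
      rw [← Complex.exp_add]; ring_nf
    have h2 : Complex.exp (-θ * Complex.I) * Complex.exp (θ * Complex.I) = 1 := by
      rw [← Complex.exp_add]; simp
    rw [h1, Complex.ofReal_cos]
    linear_combination (-Complex.exp (θ * Complex.I) / 2) * Complex.two_cos (θ : ℂ) - h2 / 2 -
      Complex.exp (θ * Complex.I) ^ 2 / 2 * Complex.I_sq
  rw [integral_eq_sub_of_hasDerivAt (fun θ _ => hderiv θ)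
    (Continuous.intervalIntegrable (by fun_prop) _ _)]
  have h : Complex.exp (2 * ((3 * π / 2 : ℝ) : ℂ) * Complex.I) =
      Complex.exp (2 * ((-(π / 2) : ℝ) : ℂ) * Complex.I) :=
    Complex.exp_eq_exp_iff_exists_int.2 ⟨2, by push_cast; ring⟩
  rw [h]
  push_cast
  ring

theorem evolution_wavePacket_focusingWeight (t : ℝ) :
    evolution t (wavePacket (focusingWeight t)) 0 = π := by
  rw [evolution_wavePacket_apply, ← integral_cos_mul_exp_I]
  refine integral_congr fun θ _ => ?_
  simp only [focusingWeight, ContinuousMap.coe_mk, Int.cast_zero, zero_mul, Complex.ofReal_zero,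
    Complex.exp_zero, mul_one]
  rw [mul_left_comm, ← Complex.exp_add, add_neg_cancel, Complex.exp_zero, mul_one]

end LatticeSchrodinger

theorem lemmaA :
    ∃ δ : ℝ, 0 < δ ∧ ∀ t : ℝ, 0 ≤ t →
      ∃ (a : ℤ → ℂ) (ha : ∀ j, ‖a j‖ ≤ 1),
        δ * t ^ (1 / 2 : ℝ) ≤
          ‖LatticeSchrodinger.evolution t (LatticeSchrodinger.initialDatum a ha) 0‖ := by
  open LatticeSchrodinger Real in
  -- The value reached is `b * π = √(2 * t) / 5`, at least `√t / 5`.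
  refine ⟨1 / 5, by norm_num, fun t ht => ?_⟩
  rcases ht.eq_or_lt with rfl | ht
  · refine ⟨0, by simp, ?_⟩
    rw [zero_rpow (by norm_num), mul_zero]
    exact norm_nonneg _
  have hpi := pi_pos
  have hs : 0 < √(2 * t) := sqrt_pos.2 (by positivity)
  set b : ℝ := √(2 * t) / (5 * π) with hb
  have hbpos : 0 < b := by positivity
  have ha : ∀ j, ‖(b : ℂ) * wavePacket (focusingWeight t) j‖ ≤ 1 := fun j => by
    rw [norm_mul, Complex.norm_real, norm_of_nonneg hbpos.le]
    calc b * _ ≤ b * (5 * π / √(2 * t)) := by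
          gcongr; exact norm_wavePacket_focusingWeight_le ht j
      _ = 1 := by rw [hb]; field_simp
  refine ⟨_, ha, ?_⟩
  have hdatum : initialDatum _ ha = (b : ℂ) • wavePacket (focusingWeight t) :=
    Subtype.ext (funext fun n => tsum_delta _ n)
  rw [hdatum, map_smul]
  change _ ≤ ‖(b : ℂ) * evolution t (wavePacket (focusingWeight t)) 0‖
  rw [evolution_wavePacket_focusingWeight, norm_mul, Complex.norm_real, Complex.norm_real,
    norm_of_nonneg hbpos.le, norm_of_nonneg hpi.le, ← sqrt_eq_rpow]
  have h1 : √t ≤ √(2 * t) := sqrt_le_sqrt (by linarith)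
  have h2 : b * π = 1 / 5 * √(2 * t) := by rw [hb]; field_simp
  rw [h2]
  gcongr
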